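/- A convex polyhedron $P\subset\mathbb R^3$ (a bounded intersection of finitely many closed half-spaces, with nonempty interior) is called $k$-equiprojective if its orthogonal projection to the plane $v^\perp$ is a convex $k$-gon for every direction $v\neq 0$ that is not parallel to any (two-dimensional) face of $P$. Let $P$ be an arbitrary quadrilateral pyramid in $\mathbb R^3$: its base is a (strictly) convex quadrilateral $B_0B_1B_2B_3$, with the vertices listed in cyclic order and indices taken modulo $4$, and its apex $O$ does not lie in the plane of the base. The four lateral edges are partitioned into the two paths $B_0OB_2$ and $B_1OB_3$ of opposite edges; each path lies in a plane. Cut $P$ by the following five planes: - (top cut) a plane parallel to the base through a point of the lateral edge $OB_0$ different from its two ends; it cuts off the apex $O$; - (side cuts) for each $i\in\{0,1,2,3\}$, a plane through a point of the lateral edge $OB_i$, different from its two ends, parallel to the plane $B_{i+1}OB_{i+3}$ of the path that does not end at $B_i$; it cuts off the base vertex $B_i$. The cuts are made so that no two of them meet in $P$, that is, the plane sections of $P$ by the five cutting planes are pairwise disjoint. The part $P'$ of $P$ that remains (on the base side of the top cut, and on the apex side of every side cut) is called an equitruncated pyramid. Theorem. Every equitruncated pyramid $P'$ is $10$-equiprojective.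 -/

import Mathlib

open scoped InnerProductSpace

/-- Euclidean three-space. -/
abbrev Space3 : Type := EuclideanSpace ℝ (Fin 3)

/-- A (bounded, full-dimensional) convex polyhedron: a bounded intersection of finitely many
closed half-spaces, with nonempty interior. -/
def IsConvexPolyhedron (P : Set Space3) : Prop :=
  (∃ H : Finset (Space3 × ℝ), P = {x | ∀ h ∈ H, ⟪h.1, x⟫_ℝ ≤ h.2}) ∧
    Bornology.IsBounded P ∧ (interior P).Nonempty

/-- `F` is a (two-dimensional) face of `P`: the set where some supporting plane touches `P`, of
dimension two. -/
def IsFacet (P F : Set Space3) : Prop :=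
  IsExposed ℝ P F ∧ F.Nonempty ∧ Module.finrank ℝ (vectorSpan ℝ F) = 2

/-- The direction `v` is parallel to some face of `P`. -/
def IsParallelToFace (P : Set Space3) (v : Space3) : Prop :=
  ∃ F, IsFacet P F ∧ v ∈ vectorSpan ℝ F

/-- The shadow of `P` in direction `v`: its orthogonal projection to the plane `v^⊥`. -/
noncomputable def shadow (P : Set Space3) (v : Space3) : Set Space3 :=
  (ℝ ∙ v)ᗮ.starProjection '' P

/-- `S` is a convex `k`-gon (with its inside): it is two-dimensional and it is the convex hull of
`k` points, none of which lies in the convex hull of the others. -/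
def IsConvexPolygon (k : ℕ) (S : Set Space3) : Prop :=
  Module.finrank ℝ (vectorSpan ℝ S) = 2 ∧
    ∃ s : Finset Space3, s.card = k ∧ ConvexIndependent ℝ ((↑) : s → Space3) ∧
      S = convexHull ℝ (s : Set Space3)

/-- `P` is a `k`-equiprojective convex polyhedron: its shadow is a `k`-gon in every direction that
is not parallel to a face. -/
def IsEquiprojective (k : ℕ) (P : Set Space3) : Prop :=
  IsConvexPolyhedron P ∧
    ∀ v : Space3, v ≠ 0 → ¬ IsParallelToFace P v → IsConvexPolygon k (shadow P v)

/-- An arbitrary pyramid over a convex quadrilateral. The base vertices `base 0, …, base 3` are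
listed in cyclic order (indices modulo 4): no three of them are collinear and the two diagonals
cross, which makes them the consecutive vertices of a (planar) strictly convex quadrilateral. -/
structure QuadPyramid where
  apex : Space3
  base : Fin 4 → Space3
  base_not_collinear : ∀ i : Fin 4, ¬ Collinear ℝ {base i, base (i + 1), base (i + 2)}
  diagonals_cross : (openSegment ℝ (base 0) (base 2) ∩ openSegment ℝ (base 1) (base 3)).Nonempty
  apex_notMem : apex ∉ affineSpan ℝ (Set.range base)

namespace QuadPyramid

/-- The pyramid as a solid. -/
def solid (Q : QuadPyramid) : Set Space3 :=
  convexHull ℝ (insert Q.apex (Set.range Q.base))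

/-- The plane through `p` parallel to the base. -/
noncomputable def topPlane (Q : QuadPyramid) (p : Space3) : AffineSubspace ℝ Space3 :=
  AffineSubspace.mk' p (vectorSpan ℝ (Set.range Q.base))

/-- The four lateral edges form two paths of opposite edges,
`base 0 - apex - base 2` and `base 1 - apex - base 3`. The path that does not end at `base i` is
`base (i + 1) - apex - base (i + 3)`; this is the plane through `p` parallel to the plane of that
path. -/
noncomputable def sidePlane (Q : QuadPyramid) (i : Fin 4) (p : Space3) :
    AffineSubspace ℝ Space3 :=
  AffineSubspace.mk' p (vectorSpan ℝ {Q.base (i + 1), Q.apex, Q.base (i + 3)})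

/-- The cuts of a quadrilateral pyramid: a top cut through a point of a lateral edge, and for each
base vertex a side cut through a point of the lateral edge that ends there (each cutting point is
different from the ends of the edge). No two of the five cuts meet in the pyramid. -/
structure Cuts (Q : QuadPyramid) where
  top : Space3
  side : Fin 4 → Space3
  top_mem : top ∈ openSegment ℝ Q.apex (Q.base 0)
  side_mem : ∀ i, side i ∈ openSegment ℝ Q.apex (Q.base i)
  top_disjoint : ∀ i,
    Disjoint (Q.solid ∩ Q.topPlane top) (Q.solid ∩ Q.sidePlane i (side i))
  side_disjoint : ∀ i j, i ≠ j →
    Disjoint (Q.solid ∩ Q.sidePlane i (side i)) (Q.solid ∩ Q.sidePlane j (side j))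

/-- The equitruncated pyramid: the part of the pyramid that remains after all cuts. The top cut
keeps the side of the base, and each side cut keeps the side of the apex (`WSameSide` includes the
points of the cutting plane itself). -/
def Cuts.equitruncated {Q : QuadPyramid} (c : Q.Cuts) : Set Space3 :=
  {x ∈ Q.solid | (Q.topPlane c.top).WSameSide (Q.base 0) x ∧
    ∀ i, (Q.sidePlane i (c.side i)).WSameSide Q.apex x}

end QuadPyramid

/-! Fix a direction `v` parallel to no face. A vertex projects to a corner of the shadow exactly
when the line through it along `v` meets the solid nowhere else, that is, when the outer normals of
the facets through it do not all have the same sign on `v` (`IsMixed`). Distinct mixed vertices have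
distinct shadows, so the number of corners is the number of mixed vertices (`extremePoints_shadow`,
`isConvexPolygon_shadow`). It depends only on the incidences and on the signs of the facet normals
on `v`.

With the apex at the origin, let `h` be the height, equal to 1 on the base, and let `x i` be the
linear form that vanishes on the path avoiding `b i` and equals 1 at `b i`; then `x (i + 2)` is a
negative multiple of `x i`. The pyramid is `h ≤ 1`, `x i + x (i + 1) ≤ h`, and the cuts add `τ ≤ h`,
`x i ≤ s i`. Disjointness of the cuts gives `τ < s i` and `1 < s i + s (i + 1)`, which fixes the
combinatorial type: 10 facets and 16 vertices, each on exactly three facets.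

Top and base have opposite signs, and so do opposite side cuts. A side cut is parallel to the two
lateral edges of the other path, so its normal is proportional to a difference of the normals of the
lateral facets at either edge; moreover the normals of a lateral facet and of the base add up to
those of the two adjacent cuts. Every sign pattern obeying the resulting implications has exactly 10
mixed vertices, by a finite check (`card_mixed_signs`). -/

/-- A polytope given both by finitely many linear inequalities `normal f x ≤ bound f` and by a list
of points containing all its extreme points, together with the incidences `f ∈ tight i` between the
points and the inequalities. -/
structure FacetVertexSystem (F ι : Type) where
  normal : F → StrongDual ℝ Space3
  bound : F → ℝ
  vertex : ι → Space3
  tight : ι → Finset F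
  eq_of_mem : ∀ i, ∀ f ∈ tight i, normal f (vertex i) = bound f
  lt_of_notMem : ∀ i, ∀ f ∉ tight i, normal f (vertex i) < bound f
  eq_zero_of_tight : ∀ i d, (∀ f ∈ tight i, normal f d = 0) → d = 0
  tight_injective : Function.Injective tight

/-! ### Polytopes given by inequalities and vertices -/

namespace FacetVertexSystem

variable {F ι : Type} (S : FacetVertexSystem F ι)

/-- The solid cut out by the inequalities. -/
def carrier : Set Space3 := {x | ∀ f, S.normal f x ≤ S.bound f}

theorem normal_vertex_le (i : ι) (f : F) : S.normal f (S.vertex i) ≤ S.bound f := by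
  by_cases h : f ∈ S.tight i
  · exact (S.eq_of_mem i f h).le
  · exact (S.lt_of_notMem i f h).le

theorem vertex_mem (i : ι) : S.vertex i ∈ S.carrier := fun f => S.normal_vertex_le i f

theorem mem_tight_iff (i : ι) (f : F) :
    f ∈ S.tight i ↔ S.normal f (S.vertex i) = S.bound f :=
  ⟨S.eq_of_mem i f, fun h => by_contra fun hf => (S.lt_of_notMem i f hf).ne h⟩

theorem vertex_injective : Function.Injective S.vertex := by
  intro i j hij
  apply S.tight_injective
  ext f
  rw [S.mem_tight_iff, S.mem_tight_iff, hij]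

theorem isClosed_carrier : IsClosed S.carrier := by
  have : S.carrier = ⋂ f, {x | S.normal f x ≤ S.bound f} := by
    ext x; simp [carrier]
  rw [this]
  exact isClosed_iInter fun f => isClosed_le (S.normal f).continuous continuous_const

theorem convex_carrier : Convex ℝ S.carrier := by
  have : S.carrier = ⋂ f, {x | S.normal f x ≤ S.bound f} := by
    ext x; simp [carrier]
  rw [this]
  exact convex_iInter fun f => convex_halfSpace_le (S.normal f).isLinear _

/-- A small move in a direction that respects all tight inequalities stays in the solid. -/
theorem exists_pos_add_smul_mem [Finite F] {x : Space3} (hx : x ∈ S.carrier) (d : Space3)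
    (hd : ∀ f, S.normal f x = S.bound f → S.normal f d ≤ 0) :
    ∃ ε > (0 : ℝ), x + ε • d ∈ S.carrier := by
  have key : ∀ f, ∀ᶠ ε in nhdsWithin (0 : ℝ) (Set.Ioi 0),
      S.normal f (x + ε • d) ≤ S.bound f := by
    intro f
    rcases (hx f).eq_or_lt with h | h
    · filter_upwards [self_mem_nhdsWithin] with ε hε
      have := mul_nonneg_of_nonpos_of_nonpos (neg_nonpos.2 (le_of_lt hε)) (hd f h)
      simp only [map_add, map_smul, smul_eq_mul]
      linarith
    · have hc : Continuous fun ε : ℝ => S.normal f (x + ε • d) := by fun_prop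
      have h0 : S.normal f (x + (0 : ℝ) • d) < S.bound f := by simpa using h
      exact ((hc.continuousAt.eventually_lt continuousAt_const h0).mono
        fun _ => le_of_lt).filter_mono nhdsWithin_le_nhds
  obtain ⟨ε, h1, h2⟩ := ((Filter.eventually_all.2 key).and self_mem_nhdsWithin).exists
  exact ⟨ε, h2, h1⟩

/-- A direction annihilated by all tight inequalities gives a segment through the point. -/
theorem exists_mem_openSegment [Finite F] {x : Space3} (hx : x ∈ S.carrier) (d : Space3)
    (hd : ∀ f, S.normal f x = S.bound f → S.normal f d = 0) :
    ∃ y ∈ S.carrier, ∃ z ∈ S.carrier, x ∈ openSegment ℝ y z ∧ (y = x → d = 0) ∧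
      ∃ ε > (0 : ℝ), y = x + ε • d := by
  obtain ⟨ε, hε, h1⟩ := S.exists_pos_add_smul_mem hx d fun f hf => (hd f hf).le
  obtain ⟨δ, hδ, h2⟩ := S.exists_pos_add_smul_mem hx (-d) fun f hf => by simp [hd f hf]
  refine ⟨_, h1, _, h2, ⟨δ / (ε + δ), ε / (ε + δ), by positivity, by positivity, by
    field_simp; ring, by
    have : ε + δ ≠ 0 := by positivity
    match_scalars <;> field_simp <;> ring⟩, fun h => ?_, ε, hε, rfl⟩
  have h0 : ε • d = 0 := by simpa using h
  exact (smul_eq_zero.1 h0).resolve_left hε.ne'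

/-- At an extreme point the tight inequalities determine the point. -/
theorem eq_zero_of_extreme [Finite F] {x : Space3} (hx : x ∈ S.carrier.extremePoints ℝ) (d : Space3)
    (hd : ∀ f, S.normal f x = S.bound f → S.normal f d = 0) : d = 0 := by
  obtain ⟨y, h1, z, h2, h, hyd, -⟩ := S.exists_mem_openSegment hx.1 d hd
  exact hyd (hx.2 h1 h2 h)

theorem vertex_mem_extremePoints (i : ι) : S.vertex i ∈ S.carrier.extremePoints ℝ := by
  refine ⟨S.vertex_mem i, fun x hx y hy ⟨a, b, ha, hb, hab, h⟩ => ?_⟩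
  refine sub_eq_zero.1 (S.eq_zero_of_tight i _ fun f hf => ?_)
  have h1 := S.eq_of_mem i f hf
  have h2 := hx f
  have h3 := hy f
  have h4 : a * S.normal f x + b * S.normal f y = S.bound f := by
    rw [← h1, ← h]; simp
  have h5 : a * S.bound f + b * S.bound f = S.bound f := by rw [← add_mul, hab, one_mul]
  have h6 : S.normal f x = S.bound f := by
    nlinarith [mul_le_mul_of_nonneg_left h3 hb.le, mul_le_mul_of_nonneg_left h2 ha.le]
  rw [map_sub, h6, h1, sub_self]

/-- The average of a nonempty set of vertices satisfies strictly all the inequalities that are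
strict at one of them. -/
theorem exists_average (A : Finset ι) (hA : A.Nonempty) :
    ∃ z ∈ S.carrier, (∀ f, (∀ i ∈ A, f ∈ S.tight i) → S.normal f z = S.bound f) ∧
      ∀ f, (∃ i ∈ A, f ∉ S.tight i) → S.normal f z < S.bound f := by
  have hc : (0 : ℝ) < A.card := by exact_mod_cast hA.card_pos
  have hz (f : F) : S.normal f ((A.card : ℝ)⁻¹ • ∑ i ∈ A, S.vertex i) =
      (A.card : ℝ)⁻¹ * ∑ i ∈ A, S.normal f (S.vertex i) := by
    rw [map_smul, map_sum, smul_eq_mul]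
  have hb (f : F) : S.bound f = (A.card : ℝ)⁻¹ * ∑ i ∈ A, S.bound f := by
    rw [Finset.sum_const, nsmul_eq_mul]; field_simp
  refine ⟨(A.card : ℝ)⁻¹ • ∑ i ∈ A, S.vertex i, fun f => ?_, fun f hf => ?_, fun f hf => ?_⟩
  · rw [hz, hb f]
    gcongr with i
    exact S.normal_vertex_le i f
  · rw [hz, hb f, Finset.sum_congr rfl fun i hi => S.eq_of_mem i f (hf i hi)]
  · obtain ⟨i, hi, hif⟩ := hf
    rw [hz, hb f]
    refine mul_lt_mul_of_pos_left ?_ (inv_pos.2 hc)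
    exact Finset.sum_lt_sum (fun j _ => S.normal_vertex_le j f) ⟨i, hi, S.lt_of_notMem i f hif⟩

theorem mem_interior_of_lt [Finite F] {z : Space3} (hz : ∀ f, S.normal f z < S.bound f) :
    z ∈ interior S.carrier := by
  have : IsOpen (⋂ f, {x | S.normal f x < S.bound f}) :=
    isOpen_iInter_of_finite fun f => isOpen_lt (S.normal f).continuous continuous_const
  refine interior_maximal (fun x hx f => ?_) this (by simpa using hz)
  exact le_of_lt (by simpa using Set.mem_iInter.1 hx f)

theorem isConvexPolyhedron [Fintype F] (hb : Bornology.IsBounded S.carrier)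
    (hi : (interior S.carrier).Nonempty) : IsConvexPolyhedron S.carrier := by
  classical
  refine ⟨⟨Finset.univ.image fun f =>
    ((InnerProductSpace.toDual ℝ Space3).symm (S.normal f), S.bound f), ?_⟩, hb, hi⟩
  ext x
  simp [carrier]

/-- The set where an inequality is tight is a face, if each other inequality is strict at one of
its vertices; it contains all directions killed by the normal. -/
theorem isParallelToFace_of_normal_eq_zero [Finite F] [Fintype ι] (f : F)
    (hf : ∃ i, f ∈ S.tight i) (hf' : ∃ i, f ∉ S.tight i)
    (hg : ∀ g, g ≠ f → ∃ i, f ∈ S.tight i ∧ g ∉ S.tight i) {v : Space3}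
    (hv : S.normal f v = 0) : IsParallelToFace S.carrier v := by
  classical
  -- The average of the vertices on the facet is a relative interior point of it: no other
  -- inequality is tight there.
  obtain ⟨z, hz, hzf, hzg⟩ := S.exists_average (Finset.univ.filter fun i => f ∈ S.tight i)
    (by simpa [Finset.Nonempty] using hf)
  have hzf' : S.normal f z = S.bound f := hzf f (by simp)
  have hzg' : ∀ g, g ≠ f → S.normal g z < S.bound g := fun g hgf => hzg g (by simpa using hg g hgf)
  have hne : (S.normal f : Space3 →ₗ[ℝ] ℝ) ≠ 0 := by
    intro h0
    have h0' : ∀ x, S.normal f x = 0 := fun x => LinearMap.congr_fun h0 x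
    obtain ⟨i, hi⟩ := hf'
    have := S.lt_of_notMem i f hi
    rw [← hzf', h0', h0'] at this
    exact this.false
  have hspan : vectorSpan ℝ {x ∈ S.carrier | S.normal f x = S.bound f} =
      LinearMap.ker (S.normal f : Space3 →ₗ[ℝ] ℝ) := by
    apply le_antisymm
    · refine Submodule.span_le.2 ?_
      rintro _ ⟨x, hx, y, hy, rfl⟩
      simp [hx.2, hy.2]
    · intro d hd
      have hd' : S.normal f d = 0 := hd
      obtain ⟨ε, hε, h⟩ := S.exists_pos_add_smul_mem hz d fun g h => by
        by_cases hgf : g = f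
        · exact (hgf ▸ hd').le
        · exact absurd h (hzg' g hgf).ne
      have := vsub_mem_vectorSpan ℝ
        (s := {x ∈ S.carrier | S.normal f x = S.bound f}) (p₁ := z + ε • d) (p₂ := z)
        ⟨h, by simp [hd', hzf']⟩ ⟨hz, hzf'⟩
      simp only [vsub_eq_sub, add_sub_cancel_left] at this
      exact (Submodule.smul_mem_iff _ hε.ne').1 this
  refine ⟨{x ∈ S.carrier | S.normal f x = S.bound f}, ⟨fun _ => ⟨S.normal f, ?_⟩, ⟨z, hz, hzf'⟩, ?_⟩,
    by rw [hspan]; exact hv⟩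
  · ext x
    refine and_congr_right fun hx => ⟨fun h y hy => h ▸ hy f, fun h => ?_⟩
    exact le_antisymm (hx f) (hzf' ▸ h z hz)
  · rw [hspan]
    have := Module.Dual.finrank_ker_add_one_of_ne_zero hne
    have h3 : Module.finrank ℝ Space3 = 3 := by simp
    omega

/-! ### Shadows and mixed vertices -/

/-- The signs of the normals of the facets at a vertex, in direction `v`, are not all equal. -/
def IsMixed (v : Space3) (i : ι) : Prop :=
  (∃ f ∈ S.tight i, S.normal f v < 0) ∧ ∃ f ∈ S.tight i, 0 < S.normal f v

theorem starProjection_eq_iff {v x y : Space3} :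
    (ℝ ∙ v)ᗮ.starProjection x = (ℝ ∙ v)ᗮ.starProjection y ↔ ∃ t : ℝ, y = x + t • v := by
  rw [← sub_eq_zero, ← map_sub, Submodule.starProjection_apply_eq_zero_iff,
    Submodule.orthogonal_orthogonal, Submodule.mem_span_singleton]
  constructor
  · rintro ⟨t, ht⟩
    exact ⟨-t, by rw [neg_smul, ht]; abel⟩
  · rintro ⟨t, rfl⟩
    exact ⟨-t, by simp⟩

/-- One tight inequality forbids moving forward along `v`, another forbids moving backward. -/
theorem IsMixed.eq_zero {v : Space3} {i : ι} (h : S.IsMixed v i) {t : ℝ}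
    (ht : S.vertex i + t • v ∈ S.carrier) : t = 0 := by
  obtain ⟨⟨f, hf, hfv⟩, g, hg, hgv⟩ := h
  have h1 := ht f
  have h2 := ht g
  simp only [map_add, map_smul, smul_eq_mul, S.eq_of_mem i f hf, S.eq_of_mem i g hg] at h1 h2
  nlinarith

/-- Extreme points of a linear image of a compact set lift to extreme points. At an unmixed vertex
the line along `v` enters the interior, so its shadow is the midpoint-like inner point of a segment
in the shadow. At a mixed vertex the fibre is a single point, so extremality descends to the shadow.
-/
theorem extremePoints_shadow [Finite F] (hc : IsCompact S.carrier)
    (hext : S.carrier.extremePoints ℝ ⊆ Set.range S.vertex) {v : Space3} (hv0 : v ≠ 0)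
    (hv : ∀ f, S.normal f v ≠ 0) :
    (shadow S.carrier v).extremePoints ℝ =
      (fun i => (ℝ ∙ v)ᗮ.starProjection (S.vertex i)) '' {i | S.IsMixed v i} := by
  apply Set.Subset.antisymm
  · intro y hy
    obtain ⟨x, hx, rfl⟩ := surjOn_extremePoints_image
      ((ℝ ∙ v)ᗮ.starProjection).toContinuousAffineMap hc hy
    obtain ⟨i, rfl⟩ := hext hx
    refine ⟨i, ?_, rfl⟩
    by_contra hmix
    -- All signs at an unmixed vertex agree, so one of `v`, `-v` points strictly inward.
    obtain ⟨σ, hσ⟩ : ∃ σ : ℝ, ∀ f ∈ S.tight i, S.normal f (σ • v) < 0 := by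
      by_cases h : ∃ f ∈ S.tight i, S.normal f v < 0
      · refine ⟨1, fun f hf => ?_⟩
        rw [one_smul]
        exact (hv f).lt_of_le (not_lt.1 fun hlt => hmix ⟨h, f, hf, hlt⟩)
      · push Not at h
        refine ⟨-1, fun f hf => ?_⟩
        have := (hv f).symm.lt_of_le (h f hf)
        simpa using this
    obtain ⟨u, hu⟩ : ∃ u : Space3, (ℝ ∙ v)ᗮ.starProjection u ≠ 0 := by
      by_contra! h
      have h3 : Module.finrank ℝ Space3 = 3 := by simp
      have : (ℝ ∙ v) = ⊤ := by
        refine top_le_iff.1 fun x _ => ?_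
        have := h x
        rwa [Submodule.starProjection_apply_eq_zero_iff, Submodule.orthogonal_orthogonal] at this
      have h1 := finrank_span_singleton (K := ℝ) hv0
      rw [this, finrank_top] at h1
      omega
    obtain ⟨ε, hε, hin⟩ := S.exists_pos_add_smul_mem (S.vertex_mem i) (σ • v)
      fun f hf => (hσ f ((S.mem_tight_iff i f).2 hf)).le
    -- Half of the admissible step makes the inequalities that were slack at the vertex strict as
    -- well.
    have hlt : ∀ f, S.normal f (S.vertex i + (ε / 2 * σ) • v) < S.bound f := by
      intro f
      have h1 := hin f
      simp only [map_add, map_smul, smul_eq_mul] at h1 ⊢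
      by_cases hf : f ∈ S.tight i
      · have h2 := hσ f hf
        rw [S.eq_of_mem i f hf]
        simp only [map_smul, smul_eq_mul] at h2
        nlinarith
      · linarith [S.lt_of_notMem i f hf]
    obtain ⟨y, hy1, z, hz1, hyz, -, δ, hδ, hyδ⟩ := S.exists_mem_openSegment
      (fun f => (hlt f).le) u fun f hf => absurd hf (hlt f).ne
    have hπ : (ℝ ∙ v)ᗮ.starProjection (S.vertex i) =
        (ℝ ∙ v)ᗮ.starProjection (S.vertex i + (ε / 2 * σ) • v) :=
      starProjection_eq_iff.2 ⟨_, rfl⟩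
    obtain ⟨a, b, ha, hb, hab, h⟩ := hyz
    have := hy.2 (Set.mem_image_of_mem _ hy1) (Set.mem_image_of_mem _ hz1)
      ⟨a, b, ha, hb, hab, by
        rw [← map_smul, ← map_smul, ← map_add, h]; exact hπ.symm⟩
    have h' : (ℝ ∙ v)ᗮ.starProjection y = (ℝ ∙ v)ᗮ.starProjection (S.vertex i) := this
    rw [hπ, hyδ, map_add _ _ (δ • u), add_eq_left, map_smul] at h'
    exact hu ((smul_eq_zero.1 h').resolve_left hδ.ne')
  · rintro _ ⟨i, hi, rfl⟩
    refine ⟨⟨_, S.vertex_mem i, rfl⟩, ?_⟩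
    rintro _ ⟨x, hx, rfl⟩ _ ⟨y, hy, rfl⟩ ⟨a, b, ha, hb, hab, h⟩
    have h' : (ℝ ∙ v)ᗮ.starProjection (S.vertex i) =
        (ℝ ∙ v)ᗮ.starProjection (a • x + b • y) := by
      rw [map_add, map_smul, map_smul]; exact h.symm
    obtain ⟨t, ht⟩ := starProjection_eq_iff.1 h'
    have hm := S.convex_carrier hx hy ha.le hb.le hab
    rw [ht] at hm
    have ht0 := hi.eq_zero S hm
    rw [ht0, zero_smul, add_zero] at ht
    rw [(S.vertex_mem_extremePoints i).2 hx hy ⟨a, b, ha, hb, hab, ht⟩]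

/-- By Krein–Milman the shadow is the hull of its extreme points; the projection is injective on
mixed vertices, so these points can be counted upstairs. -/
theorem isConvexPolygon_shadow [Finite F] [Finite ι] (hc : IsCompact S.carrier)
    (hi : (interior S.carrier).Nonempty)
    (hext : S.carrier.extremePoints ℝ ⊆ Set.range S.vertex) {v : Space3} (hv0 : v ≠ 0)
    (hv : ∀ f, S.normal f v ≠ 0) {k : ℕ} (hk : {i | S.IsMixed v i}.ncard = k) :
    IsConvexPolygon k (shadow S.carrier v) := by
  classical
  have hE := S.extremePoints_shadow hc hext hv0 hv
  have hconv : Convex ℝ (shadow S.carrier v) :=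
    S.convex_carrier.linear_image ((ℝ ∙ v)ᗮ.starProjection : Space3 →ₗ[ℝ] Space3)
  have hfin : ((shadow S.carrier v).extremePoints ℝ).Finite := by
    rw [hE]; exact (Set.toFinite _).image _
  have hcomp : IsCompact (shadow S.carrier v) :=
    hc.image ((ℝ ∙ v)ᗮ.starProjection).continuous
  refine ⟨?_, hfin.toFinset, ?_, ?_, ?_⟩
  · have h1 : vectorSpan ℝ S.carrier = ⊤ := by
      rw [← direction_affineSpan, S.convex_carrier.interior_nonempty_iff_affineSpan_eq_top.1 hi,
        AffineSubspace.direction_top]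
    have h2 : vectorSpan ℝ (shadow S.carrier v) = (ℝ ∙ v)ᗮ := by
      have := AffineMap.map_vectorSpan (s := S.carrier)
        ((ℝ ∙ v)ᗮ.starProjection : Space3 →ₗ[ℝ] Space3).toAffineMap
      rw [h1, Submodule.map_top] at this
      exact this.symm.trans (Submodule.range_starProjection _)
    rw [h2]
    have : Fact (Module.finrank ℝ Space3 = 2 + 1) := ⟨by simp⟩
    exact Submodule.finrank_orthogonal_span_singleton hv0
  · rw [← Set.ncard_eq_toFinset_card _ hfin, hE, Set.InjOn.ncard_image, hk]
    intro i hi j hj hij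
    obtain ⟨t, ht⟩ := starProjection_eq_iff.1 hij
    have := IsMixed.eq_zero S hi (ht ▸ S.vertex_mem j)
    apply S.vertex_injective
    simpa [this] using ht.symm
  · have := hconv.convexIndependent_extremePoints
    rwa [← hfin.coe_toFinset] at this
  · rw [hfin.coe_toFinset, ← (hfin.isCompact_convexHull ℝ).isClosed.closure_eq]
    exact (closure_convexHull_extremePoints hcomp hconv).symm

end FacetVertexSystem

/-! ### Adapted coordinates on a quadrilateral pyramid -/

/-- Linear coordinates adapted to the lateral edge vectors `b 0, …, b 3` of a quadrilateral pyramid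
with apex at the origin: `height` is one on the base, and `side i` vanishes on the plane of the path
that does not end at `b i` and is one at `b i`. -/
structure PyramidFrame (b : Fin 4 → Space3) where
  height : StrongDual ℝ Space3
  side : Fin 4 → StrongDual ℝ Space3
  ratio : Fin 4 → ℝ
  ratio_pos : ∀ i, 0 < ratio i
  height_edge : ∀ i, height (b i) = 1
  side_self : ∀ i, side i (b i) = 1
  side_edge_add_one : ∀ i, side i (b (i + 1)) = 0
  side_add_two : ∀ i x, side (i + 2) x = -(ratio i * side i x)
  eq_zero_of_side_zero : ∀ x, side 0 x = 0 → side 1 x = 0 → height x = 0 → x = 0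

namespace PyramidFrame

variable {b : Fin 4 → Space3} (F : PyramidFrame b)

theorem side_add_three (i : Fin 4) (x : Space3) :
    F.side (i + 3) x = -(F.ratio (i + 1) * F.side (i + 1) x) := by
  have := F.side_add_two (i + 1) x
  rwa [show i + 1 + 2 = i + 3 by omega] at this

theorem side_eq_neg (i : Fin 4) (x : Space3) :
    F.side i x = -(F.ratio (i + 2) * F.side (i + 2) x) := by
  have := F.side_add_two (i + 2) x
  rwa [show i + 2 + 2 = i by omega] at this

theorem side_edge_add_two (i : Fin 4) : F.side i (b (i + 2)) = -F.ratio (i + 2) := by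
  rw [F.side_eq_neg, F.side_self, mul_one]

theorem side_edge_add_three (i : Fin 4) : F.side i (b (i + 3)) = 0 := by
  have := F.side_edge_add_one (i + 2)
  rw [show i + 2 + 1 = i + 3 by omega] at this
  rw [F.side_eq_neg, this, mul_zero, neg_zero]

theorem side_add_one_edge (i : Fin 4) : F.side (i + 1) (b i) = 0 := by
  have := F.side_edge_add_three (i + 1)
  rwa [show i + 1 + 3 = i by omega] at this

theorem side_add_one_edge_add_two (i : Fin 4) : F.side (i + 1) (b (i + 2)) = 0 := by
  have := F.side_edge_add_one (i + 1)
  rwa [show i + 1 + 1 = i + 2 by omega] at this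

theorem side_add_one_edge_add_three (i : Fin 4) :
    F.side (i + 1) (b (i + 3)) = -F.ratio (i + 3) := by
  have := F.side_edge_add_two (i + 1)
  rwa [show i + 1 + 2 = i + 3 by omega] at this

theorem ratio_mul_ratio (i : Fin 4) : F.ratio i * F.ratio (i + 2) = 1 := by
  have := F.side_add_two i (b (i + 2))
  rw [F.side_self, F.side_edge_add_two] at this
  linarith

theorem ratio_add_one_mul_ratio (i : Fin 4) : F.ratio (i + 1) * F.ratio (i + 3) = 1 := by
  have := F.ratio_mul_ratio (i + 1)
  rwa [show i + 1 + 2 = i + 3 by omega] at this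

theorem side_eq_zero {i : Fin 4} {x : Space3} (h : F.side i x = 0) : F.side (i + 2) x = 0 := by
  rw [F.side_add_two, h, mul_zero, neg_zero]

theorem eq_zero (i : Fin 4) {x : Space3} (h0 : F.side i x = 0) (h1 : F.side (i + 1) x = 0)
    (h : F.height x = 0) : x = 0 := by
  have h2 := F.side_eq_zero h0
  have h3 := F.side_eq_zero h1
  have : F.side 0 x = 0 ∧ F.side 1 x = 0 := by
    fin_cases i <;> exact ⟨by assumption, by assumption⟩
  exact F.eq_zero_of_side_zero x this.1 this.2 h

theorem ext_coord (i : Fin 4) {x y : Space3} (h0 : F.side i x = F.side i y)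
    (h1 : F.side (i + 1) x = F.side (i + 1) y) (h : F.height x = F.height y) : x = y :=
  sub_eq_zero.1 <| F.eq_zero i (by simp [h0]) (by simp [h1]) (by simp [h])

/-- The crossing point of the diagonals of the base. -/
noncomputable def cross : Space3 := (1 + F.ratio 0)⁻¹ • (b 0 + F.ratio 0 • b 2)

theorem height_cross : F.height F.cross = 1 := by
  have := F.ratio_pos 0
  simp only [cross, map_smul, map_add, F.height_edge, smul_eq_mul]
  field_simp

theorem side_cross (i : Fin 4) : F.side i F.cross = 0 := by
  have h0 : F.side 0 F.cross = 0 := by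
    have h1 := F.side_edge_add_two 0
    have h2 := F.ratio_mul_ratio 0
    rw [zero_add] at h1 h2
    simp only [cross, map_smul, map_add, F.side_self, smul_eq_mul, h1]
    rw [mul_neg, h2]; simp
  have h1 : F.side 1 F.cross = 0 := by
    have h1 : F.side 1 (b 0) = 0 := F.side_add_one_edge 0
    have h2 : F.side 1 (b 2) = 0 := F.side_add_one_edge_add_two 0
    simp only [cross, map_smul, map_add, smul_eq_mul]
    rw [h1, h2]; simp
  have h2 := F.side_eq_zero h0
  have h3 := F.side_eq_zero h1
  fin_cases i <;> assumption

theorem cross_eq (i : Fin 4) :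
    F.cross = (1 + F.ratio i)⁻¹ • (b i + F.ratio i • b (i + 2)) := by
  have := F.ratio_pos i
  apply F.ext_coord i
  · simp [F.side_cross, F.side_self, F.side_edge_add_two, F.ratio_mul_ratio]
  · simp [F.side_cross, F.side_add_one_edge, F.side_add_one_edge_add_two]
  · simp only [F.height_cross, map_smul, map_add, F.height_edge, smul_eq_mul]
    field_simp

theorem cross_mem_segment (i : Fin 4) : F.cross ∈ segment ℝ (b i) (b (i + 2)) := by
  have := F.ratio_pos i
  refine ⟨(1 + F.ratio i)⁻¹, (1 + F.ratio i)⁻¹ * F.ratio i, by positivity, by positivity, ?_, ?_⟩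
  · field_simp
  · rw [F.cross_eq i, smul_add, mul_smul]

theorem eq_combination (i : Fin 4) (x : Space3) :
    x = F.side i x • b i + F.side (i + 1) x • b (i + 1) +
      (F.height x - F.side i x - F.side (i + 1) x) • F.cross := by
  apply F.ext_coord i <;>
  simp [F.side_cross, F.height_cross, F.side_self, F.side_edge_add_one, F.side_add_one_edge,
    F.height_edge]

/-- Every point lies over one of the four quadrants cut out by the diagonal planes. -/
theorem exists_quadrant (x : Space3) : ∃ i, 0 ≤ F.side i x ∧ 0 ≤ F.side (i + 1) x := by
  -- Opposite side forms have opposite signs, so one form of each opposite pair is nonnegative.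
  have key : ∀ i, 0 ≤ F.side i x ∨ 0 ≤ F.side (i + 2) x := fun i => by
    rw [or_iff_not_imp_left, not_le, F.side_add_two]
    intro h
    nlinarith [F.ratio_pos i]
  rcases key 0 with h0 | h0 <;> rcases key 1 with h1 | h1
  exacts [⟨0, h0, h1⟩, ⟨3, h1, h0⟩, ⟨1, h1, h0⟩, ⟨2, h0, h1⟩]

/-- Over quadrant `i` the pyramid is the tetrahedron on the apex, `b i`, `b (i + 1)` and the
crossing point of the diagonals. The coefficients in `eq_combination`, completed by `1 - height`,
are barycentric coordinates there. -/
theorem mem_convexHull_iff (x : Space3) :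
    x ∈ convexHull ℝ (insert 0 (Set.range b)) ↔
      F.height x ≤ 1 ∧ ∀ i, F.side i x + F.side (i + 1) x ≤ F.height x := by
  constructor
  · intro hx
    have hconv : Convex ℝ {x | F.height x ≤ 1 ∧
        ∀ i, F.side i x + F.side (i + 1) x ≤ F.height x} := by
      rintro x ⟨h1, h2⟩ y ⟨h3, h4⟩ s t hs ht hst
      simp only [Set.mem_ofPred_eq, map_add, map_smul, smul_eq_mul]
      refine ⟨by nlinarith, fun i => ?_⟩
      nlinarith [mul_le_mul_of_nonneg_left (h2 i) hs, mul_le_mul_of_nonneg_left (h4 i) ht]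
    refine convexHull_min ?_ hconv hx
    rintro _ (rfl | ⟨j, rfl⟩)
    · simp
    · refine ⟨(F.height_edge j).le, fun i => ?_⟩
      rw [F.height_edge]
      obtain rfl | rfl | rfl | rfl : j = i ∨ j = i + 1 ∨ j = i + 2 ∨ j = i + 3 := by omega
      · simp [F.side_self, F.side_add_one_edge]
      · simp [F.side_self, F.side_edge_add_one]
      · simp only [F.side_edge_add_two, F.side_add_one_edge_add_two]
        linarith [F.ratio_pos (i + 2)]
      · simp only [F.side_edge_add_three, F.side_add_one_edge_add_three]
        linarith [F.ratio_pos (i + 3)]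
  · rintro ⟨h1, h2⟩
    obtain ⟨i, hi, hi'⟩ := F.exists_quadrant x
    have hb : ∀ j, b j ∈ convexHull ℝ (insert 0 (Set.range b)) := fun j =>
      subset_convexHull ℝ _ (Or.inr ⟨j, rfl⟩)
    have h0 : (0 : Space3) ∈ convexHull ℝ (insert 0 (Set.range b)) :=
      subset_convexHull ℝ _ (Or.inl rfl)
    have hc : F.cross ∈ convexHull ℝ (insert 0 (Set.range b)) :=
      (convex_convexHull ℝ _).segment_subset (hb 0) (hb 2) (F.cross_mem_segment 0)
    have := (convex_convexHull ℝ (insert 0 (Set.range b))).sum_mem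
      (t := Finset.univ) (w := ![F.side i x, F.side (i + 1) x,
        F.height x - F.side i x - F.side (i + 1) x, 1 - F.height x])
      (z := ![b i, b (i + 1), F.cross, 0])
      (by
        have := h2 i
        intro j _
        fin_cases j <;> simp <;> linarith)
      (by simp [Fin.sum_univ_four])
      (by
        intro j _
        fin_cases j
        exacts [hb i, hb (i + 1), hc, h0])
    rw [F.eq_combination i x]
    simpa [Fin.sum_univ_four] using this

theorem vectorSpan_base (o : Space3) :
    vectorSpan ℝ (Set.range fun i => o + b i) =
      LinearMap.ker (F.height : Space3 →ₗ[ℝ] ℝ) := by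
  apply le_antisymm
  · refine Submodule.span_le.2 ?_
    rintro _ ⟨_, ⟨i, rfl⟩, _, ⟨j, rfl⟩, rfl⟩
    simp [F.height_edge]
  · intro x hx
    have hx' : F.height x = 0 := hx
    have hmem : ∀ i j, b i - b j ∈ vectorSpan ℝ (Set.range fun i => o + b i) := fun i j => by
      have := vsub_mem_vectorSpan ℝ (Set.mem_range_self (f := fun i => o + b i) i)
        (Set.mem_range_self (f := fun i => o + b i) j)
      simpa using this
    have h0 := F.ratio_mul_ratio 0
    have h1 := F.ratio_mul_ratio 1
    have hp0 := F.ratio_pos (0 + 2)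
    have hp1 := F.ratio_pos (1 + 2)
    have : x = (F.side 0 x / (1 + F.ratio (0 + 2))) • (b 0 - b (0 + 2)) +
        (F.side (0 + 1) x / (1 + F.ratio (0 + 3))) • (b (0 + 1) - b (0 + 3)) := by
      have : (1 : ℝ) + F.ratio (0 + 2) ≠ 0 := by positivity
      have : (1 : ℝ) + F.ratio (0 + 3) ≠ 0 := by have := F.ratio_pos (0 + 3); positivity
      apply F.ext_coord 0
      · simp only [map_add, map_sub, map_smul, smul_eq_mul, F.side_self, F.side_edge_add_two,
          F.side_edge_add_one, F.side_edge_add_three]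
        field_simp
        ring
      · simp only [map_add, map_sub, map_smul, smul_eq_mul, F.side_self, F.side_add_one_edge,
          F.side_add_one_edge_add_two, F.side_add_one_edge_add_three]
        field_simp
        ring
      · simp [F.height_edge, hx']
    rw [this]
    exact add_mem (Submodule.smul_mem _ _ (hmem _ _)) (Submodule.smul_mem _ _ (hmem _ _))

theorem vectorSpan_path (o : Space3) (i : Fin 4) :
    vectorSpan ℝ {o + b (i + 1), o, o + b (i + 3)} =
      LinearMap.ker (F.side i : Space3 →ₗ[ℝ] ℝ) := by
  apply le_antisymm
  · refine Submodule.span_le.2 ?_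
    rintro _ ⟨x, hx, y, hy, rfl⟩
    have : ∀ z ∈ ({o + b (i + 1), o, o + b (i + 3)} : Set Space3), F.side i z = F.side i o := by
      rintro _ (rfl | rfl | rfl) <;> simp [F.side_edge_add_one, F.side_edge_add_three]
    simp [this x hx, this y hy]
  · intro x hx
    have hx' : F.side i x = 0 := hx
    have h1 : b (i + 1) ∈ vectorSpan ℝ {o + b (i + 1), o, o + b (i + 3)} := by
      have := vsub_mem_vectorSpan ℝ (s := {o + b (i + 1), o, o + b (i + 3)})
        (p₁ := o + b (i + 1)) (p₂ := o) (by simp) (by simp)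
      simpa using this
    have h3 : b (i + 3) ∈ vectorSpan ℝ {o + b (i + 1), o, o + b (i + 3)} := by
      have := vsub_mem_vectorSpan ℝ (s := {o + b (i + 1), o, o + b (i + 3)})
        (p₁ := o + b (i + 3)) (p₂ := o) (by simp) (by simp)
      simpa using this
    have hc := F.cross_eq (i + 1)
    rw [show i + 1 + 2 = i + 3 by omega] at hc
    rw [F.eq_combination i x, hx', hc, zero_smul, zero_add]
    exact add_mem (Submodule.smul_mem _ _ h1) (Submodule.smul_mem _ _ (Submodule.smul_mem _ _
      (add_mem h1 (Submodule.smul_mem _ _ h3))))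

end PyramidFrame

/-! ### Existence of the coordinates -/

theorem QuadPyramid.linearIndependent (Q : QuadPyramid) :
    LinearIndependent ℝ ![Q.base 0 - Q.apex, Q.base 1 - Q.apex, Q.base 2 - Q.apex] := by
  have h := affineIndependent_iff_not_collinear_set.2 (Q.base_not_collinear 0)
  have h4 : AffineIndependent ℝ ![Q.apex, Q.base 0, Q.base 1, Q.base 2] := by
    refine AffineIndependent.affineIndependent_of_notMem_span (i := 0) ?_ ?_
    · rw [← affineIndependent_equiv (finSuccAboveEquiv (0 : Fin 4))]
      convert h using 1
      ext j
      fin_cases j <;> rfl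
    · refine fun hm => Q.apex_notMem (affineSpan_mono ℝ ?_ hm)
      rintro _ ⟨j, hj, rfl⟩
      fin_cases j
      exacts [absurd rfl hj, ⟨0, rfl⟩, ⟨1, rfl⟩, ⟨2, rfl⟩]
  rw [affineIndependent_iff_linearIndependent_vsub ℝ _ 0,
    ← linearIndependent_equiv (finSuccAboveEquiv (0 : Fin 4))] at h4
  have e : ((fun i : {i : Fin 4 // i ≠ 0} => ![Q.apex, Q.base 0, Q.base 1, Q.base 2] ↑i -ᵥ
      ![Q.apex, Q.base 0, Q.base 1, Q.base 2] 0) ∘ ⇑(finSuccAboveEquiv 0)) =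
      ![Q.base 0 - Q.apex, Q.base 1 - Q.apex, Q.base 2 - Q.apex] := by
    ext j : 1
    fin_cases j <;> rfl
  rwa [e] at h4

/-- Three lateral edge vectors form a basis, and the crossing of the diagonals expresses the fourth
in it. The ratios are those in which the crossing point divides the diagonals; they make the side
forms vanish where required. -/
theorem QuadPyramid.nonempty_frame (Q : QuadPyramid) :
    Nonempty (PyramidFrame fun i => Q.base i - Q.apex) := by
  set B := basisOfLinearIndependentOfCardEqFinrank Q.linearIndependent (by simp) with hB
  have hB' : ∀ i, B i = ![Q.base 0 - Q.apex, Q.base 1 - Q.apex, Q.base 2 - Q.apex] i := fun i => by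
    rw [hB, coe_basisOfLinearIndependentOfCardEqFinrank]
  have h0 : Q.base 0 - Q.apex = B 0 := (hB' 0).symm
  have h1 : Q.base 1 - Q.apex = B 1 := (hB' 1).symm
  have h2 : Q.base 2 - Q.apex = B 2 := (hB' 2).symm
  obtain ⟨_, ⟨s', s, hs', hs, hss, rfl⟩, t', t, ht', ht, htt, h⟩ := Q.diagonals_cross
  have h3 : Q.base 3 - Q.apex = (s' / t) • B 0 + (s / t) • B 2 - (t' / t) • B 1 := by
    have hb3 : Q.base 3 = t⁻¹ • (s' • Q.base 0 + s • Q.base 2 - t' • Q.base 1) := by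
      rw [← h, add_sub_cancel_left, smul_smul, inv_mul_cancel₀ ht.ne', one_smul]
    have e1 : s' = 1 - s := by linarith
    have e2 : t' = 1 - t := by linarith
    rw [← h0, ← h1, ← h2, hb3, e1, e2]
    match_scalars <;> field_simp <;> ring
  let c (j : Fin 3) : StrongDual ℝ Space3 := (B.coord j).toContinuousLinearMap
  have hc : ∀ j x, c j x = B.repr x j := fun j x => rfl
  refine ⟨⟨c 0 + c 1 + c 2,
    ![c 0 - (s' / s) • c 2, c 1, -(s / s') • c 0 + c 2, -(t / t') • c 1],
    ![s / s', t / t', s' / s, t' / t], ?_, ?_, ?_, ?_, ?_, ?_⟩⟩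
  · intro i; fin_cases i <;> (simp; positivity)
  · intro i
    fin_cases i <;> simp [h0, h1, h2, h3, hc]
    field_simp
    linarith
  · intro i
    fin_cases i <;> simp [h0, h1, h2, h3, hc]
    field_simp
  · intro i
    fin_cases i <;> simp [h0, h1, h2, h3, hc]
    field_simp
    simp
  · intro i x
    fin_cases i <;> simp [hc] <;> field_simp <;> ring
  · intro x e0 e1 e2
    simp [hc] at e0 e1 e2
    have hpos : 0 < s' / s + 1 := by positivity
    have e3 : (s' / s + 1) * B.repr x 2 = 0 := by linarith
    have e4 : B.repr x 2 = 0 := (mul_eq_zero.1 e3).resolve_left hpos.ne'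
    have e5 : B.repr x 0 = 0 := by rw [e4] at e0; linarith
    refine B.ext_elem fun j => ?_
    fin_cases j <;> simp [e1, e4, e5]

/-! ### The cuts in coordinates -/

theorem wSameSide_mk'_iff (φ : StrongDual ℝ Space3) {D : Submodule ℝ Space3}
    (hD : D = LinearMap.ker (φ : Space3 →ₗ[ℝ] ℝ)) {p a : Space3} (x : Space3) (ha : φ p < φ a) :
    (AffineSubspace.mk' p D).WSameSide a x ↔ φ p ≤ φ x := by
  have hmem : ∀ q, q ∈ AffineSubspace.mk' p D ↔ φ q = φ p := fun q => by
    rw [AffineSubspace.mem_mk', hD]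
    simp [sub_eq_zero]
  constructor
  · rintro ⟨q, hq, r, hr, h⟩
    have h' := h.map (φ : Space3 →ₗ[ℝ] ℝ)
    have e1 : (φ : Space3 →ₗ[ℝ] ℝ) (a -ᵥ q) = φ a - φ p := by simp [(hmem q).1 hq]
    have e2 : (φ : Space3 →ₗ[ℝ] ℝ) (x -ᵥ r) = φ x - φ p := by simp [(hmem r).1 hr]
    rw [e1, e2] at h'
    obtain ⟨t, ht, h⟩ := h'.exists_nonneg_left (sub_pos.2 ha).ne'
    have := mul_nonneg ht (sub_pos.2 ha).le
    rw [smul_eq_mul] at h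
    linarith
  · intro h
    have hpos := sub_pos.2 ha
    -- This multiple of `a - p` carries a point of the plane to `x`.
    set t := (φ x - φ p) / (φ a - φ p) with ht
    have ht0 : 0 ≤ t := div_nonneg (sub_nonneg.2 h) hpos.le
    have hq : x - t • (a - p) ∈ AffineSubspace.mk' p D := by
      rw [hmem]
      simp only [map_sub, map_smul, smul_eq_mul, ht]
      field_simp
      ring
    have := AffineSubspace.wSameSide_smul_vsub_vadd_right a
      ((hmem p).2 rfl) hq ht0
    simpa using this

namespace QuadPyramid

variable {Q : QuadPyramid}

open scoped Pointwise in
theorem mem_solid_iff (F : PyramidFrame fun i => Q.base i - Q.apex) (x : Space3) :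
    x ∈ Q.solid ↔ F.height (x - Q.apex) ≤ 1 ∧
      ∀ i, F.side i (x - Q.apex) + F.side (i + 1) (x - Q.apex) ≤ F.height (x - Q.apex) := by
  have : insert Q.apex (Set.range Q.base) =
      Q.apex +ᵥ insert (0 : Space3) (Set.range fun i => Q.base i - Q.apex) := by
    rw [Set.vadd_set_insert, vadd_eq_add, add_zero, ← Set.range_vadd]
    simp
  rw [solid, this, convexHull_vadd, Set.mem_vadd_set_iff_neg_vadd_mem, ← F.mem_convexHull_iff,
    vadd_eq_add, neg_add_eq_sub]

theorem vectorSpan_base_eq (F : PyramidFrame fun i => Q.base i - Q.apex) :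
    vectorSpan ℝ (Set.range Q.base) = LinearMap.ker (F.height : Space3 →ₗ[ℝ] ℝ) := by
  have := F.vectorSpan_base Q.apex
  simpa using this

theorem vectorSpan_path_eq (F : PyramidFrame fun i => Q.base i - Q.apex) (i : Fin 4) :
    vectorSpan ℝ {Q.base (i + 1), Q.apex, Q.base (i + 3)} =
      LinearMap.ker (F.side i : Space3 →ₗ[ℝ] ℝ) := by
  have := F.vectorSpan_path Q.apex i
  simpa using this

theorem mem_topPlane_iff (F : PyramidFrame fun i => Q.base i - Q.apex) (p x : Space3) :
    x ∈ Q.topPlane p ↔ F.height x = F.height p := by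
  rw [topPlane, AffineSubspace.mem_mk', vectorSpan_base_eq F]
  simp [sub_eq_zero]

theorem mem_sidePlane_iff (F : PyramidFrame fun i => Q.base i - Q.apex) (i : Fin 4)
    (p x : Space3) : x ∈ Q.sidePlane i p ↔ F.side i x = F.side i p := by
  rw [sidePlane, AffineSubspace.mem_mk', vectorSpan_path_eq F]
  simp [sub_eq_zero]

theorem exists_eq_add_smul_of_mem_openSegment {x y z : Space3} (h : z ∈ openSegment ℝ x y) :
    ∃ t : ℝ, 0 < t ∧ t < 1 ∧ z = x + t • (y - x) := by
  obtain ⟨a, t, ha, ht, hab, rfl⟩ := h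
  refine ⟨t, ht, by linarith, ?_⟩
  rw [← eq_sub_iff_add_eq] at hab
  rw [hab]
  module

/-- The equitruncated pyramid in adapted coordinates, with the position of the cuts. -/
theorem Cuts.exists_equitruncated_eq (c : Q.Cuts) (F : PyramidFrame fun i => Q.base i - Q.apex) :
    ∃ (τ : ℝ) (s : Fin 4 → ℝ), 0 < τ ∧ (∀ i, τ < s i) ∧ (∀ i, s i < 1) ∧
      (∀ i, 1 < s i + s (i + 1)) ∧ ∀ x, x ∈ c.equitruncated ↔
        F.height (x - Q.apex) ≤ 1 ∧ τ ≤ F.height (x - Q.apex) ∧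
        (∀ i, F.side i (x - Q.apex) ≤ s i) ∧
        ∀ i, F.side i (x - Q.apex) + F.side (i + 1) (x - Q.apex) ≤ F.height (x - Q.apex) := by
  obtain ⟨τ, hτ, hτ1, htop⟩ := exists_eq_add_smul_of_mem_openSegment c.top_mem
  choose s hs hs1 hside using fun i => exists_eq_add_smul_of_mem_openSegment (c.side_mem i)
  have htop' : F.height c.top = F.height Q.apex + τ := by
    rw [htop, map_add, map_smul, F.height_edge 0]; simp
  have hside' : ∀ i, F.side i (c.side i) = F.side i Q.apex + s i := fun i => by
    rw [hside i, map_add, map_smul, F.side_self i]; simp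
  refine ⟨τ, s, hτ, fun i => ?_, hs1, fun i => ?_, fun x => ?_⟩
  · by_contra! hle
    have hdis := Set.disjoint_left.1 (c.top_disjoint i)
    have h0 := F.height_edge i
    have h1 := F.side_self i
    have h2 := F.side_add_one_edge i
    -- If `s i ≤ τ`, this point lies on both cuts: adding a multiple of `cross` corrects the height
    -- without changing any side form.
    have hsolid : Q.apex + (s i • (Q.base i - Q.apex) + (τ - s i) • F.cross) ∈ Q.solid := by
      rw [mem_solid_iff F, add_sub_cancel_left]
      simp only [map_add, map_smul, smul_eq_mul, h0, F.height_cross, F.side_cross, mul_one,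
        mul_zero, add_zero]
      refine ⟨by linarith, fun j => ?_⟩
      have h3 := F.side_add_two i (Q.base i - Q.apex)
      have h4 := F.side_add_three i (Q.base i - Q.apex)
      rw [h1] at h3
      rw [h2] at h4
      have := mul_pos (hs i) (F.ratio_pos i)
      obtain rfl | rfl | rfl | rfl : j = i ∨ j = i + 1 ∨ j = i + 2 ∨ j = i + 3 := by omega
      · rw [h1, h2]; linarith
      · rw [h2, show i + 1 + 1 = i + 2 by omega, h3]; linarith
      · rw [h3, show i + 2 + 1 = i + 3 by omega, h4]; linarith
      · rw [h4, show i + 3 + 1 = i by omega, h1]; linarith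
    refine hdis ⟨hsolid, ?_⟩ ⟨hsolid, ?_⟩
    · refine (mem_topPlane_iff F _ _).2 ?_
      simp only [map_add, map_smul, smul_eq_mul, h0, F.height_cross, htop']
      ring
    · refine (mem_sidePlane_iff F i _ _).2 ?_
      simp only [map_add, map_smul, smul_eq_mul, h1, F.side_cross, hside']
      ring
  · by_contra! hle
    have hdis := Set.disjoint_left.1 (c.side_disjoint i (i + 1) (by omega))
    have h0 := F.height_edge i
    have h0' := F.height_edge (i + 1)
    have h1 := F.side_self i
    have h1' := F.side_self (i + 1)
    have h2 := F.side_add_one_edge i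
    have h2' := F.side_edge_add_one i
    -- If `s i + s (i + 1) ≤ 1`, this base point lies on both side cuts; the multiple of `cross`
    -- again only raises the height, here to 1.
    have hsolid : Q.apex + (s i • (Q.base i - Q.apex) + s (i + 1) • (Q.base (i + 1) - Q.apex) +
        (1 - s i - s (i + 1)) • F.cross) ∈ Q.solid := by
      rw [mem_solid_iff F, add_sub_cancel_left]
      simp only [map_add, map_smul, smul_eq_mul, h0, h0', F.height_cross, F.side_cross, mul_one,
        mul_zero, add_zero]
      refine ⟨by linarith, fun j => ?_⟩
      have h3 := F.side_add_two i (Q.base i - Q.apex)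
      have h4 := F.side_add_three i (Q.base i - Q.apex)
      have h3' := F.side_add_two i (Q.base (i + 1) - Q.apex)
      have h4' := F.side_add_three i (Q.base (i + 1) - Q.apex)
      rw [h1] at h3
      rw [h2] at h4
      rw [h2'] at h3'
      rw [h1'] at h4'
      have := mul_pos (hs i) (F.ratio_pos i)
      have := mul_pos (hs (i + 1)) (F.ratio_pos (i + 1))
      have := hs i
      have := hs (i + 1)
      have := hs1 i
      have := hs1 (i + 1)
      obtain rfl | rfl | rfl | rfl : j = i ∨ j = i + 1 ∨ j = i + 2 ∨ j = i + 3 := by omega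
      · rw [h1, h2, h1', h2']; linarith
      · rw [h2, h1', show i + 1 + 1 = i + 2 by omega, h3, h3']; linarith
      · rw [h3, h3', show i + 2 + 1 = i + 3 by omega, h4, h4']; linarith
      · rw [h4, h4', show i + 3 + 1 = i by omega, h1, h2']; linarith
    refine hdis ⟨hsolid, ?_⟩ ⟨hsolid, ?_⟩
    · refine (mem_sidePlane_iff F i _ _).2 ?_
      simp only [map_add, map_smul, smul_eq_mul, h1, h2', F.side_cross, hside']
      ring
    · refine (mem_sidePlane_iff F (i + 1) _ _).2 ?_
      simp only [map_add, map_smul, smul_eq_mul, h1', h2, F.side_cross, hside']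
      ring
  · have ht : (Q.topPlane c.top).WSameSide (Q.base 0) x ↔ τ ≤ F.height (x - Q.apex) := by
      rw [topPlane, wSameSide_mk'_iff F.height (vectorSpan_base_eq F), htop', map_sub,
        le_sub_iff_add_le']
      have := F.height_edge 0
      rw [map_sub] at this
      linarith
    have hsd : ∀ i, (Q.sidePlane i (c.side i)).WSameSide Q.apex x ↔
        F.side i (x - Q.apex) ≤ s i := fun i => by
      -- The sign is reversed because the side form is smaller at the apex than on the cut.
      rw [sidePlane, wSameSide_mk'_iff (-F.side i)]
      · simp only [neg_apply, neg_le_neg_iff, hside', map_sub,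
          sub_le_iff_le_add']
      · rw [vectorSpan_path_eq F]
        ext y
        simp
      · simp [hside', hs i]
    rw [equitruncated, Set.mem_sep_iff, mem_solid_iff F, ht, forall_congr' hsd]
    tauto

end QuadPyramid

/-! ### Combinatorial type and the sign count -/

/-- The facets of an equitruncated pyramid. -/
inductive EquitruncatedFacet
  | top
  | base
  | cut (i : Fin 4)
  | lateral (i : Fin 4)
  deriving DecidableEq, Fintype

/-- The vertices of an equitruncated pyramid: `top i` and `edge i` lie on the lateral edge number
`i`, and `next i`, `prev i` are the two base vertices of the side cut number `i`. -/
inductive EquitruncatedVertex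
  | top (i : Fin 4)
  | edge (i : Fin 4)
  | next (i : Fin 4)
  | prev (i : Fin 4)
  deriving DecidableEq, Fintype

namespace EquitruncatedVertex

open EquitruncatedFacet

/-- The three facets that meet at a vertex. -/
def facets : EquitruncatedVertex → Finset EquitruncatedFacet
  | .top i => {.top, .lateral i, .lateral (i + 3)}
  | .edge i => {.cut i, .lateral i, .lateral (i + 3)}
  | .next i => {.cut i, .base, .lateral i}
  | .prev i => {.cut i, .base, .lateral (i + 3)}

theorem facets_injective : Function.Injective facets := by
  unfold Function.Injective
  decide +kernel

/-- No facet has its vertices among those of another. This makes each inequality define a genuine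
two-dimensional face and gives the solid an interior point. -/
theorem exists_mem_facets_and_notMem :
    ∀ f g : EquitruncatedFacet, g ≠ f → ∃ i, f ∈ facets i ∧ g ∉ facets i := by
  decide +kernel

/-- Signs of the facet normals in a direction, given those on which the others depend. -/
def signs (t c₀ c₁ l₀ l₁ l₂ l₃ : Bool) : EquitruncatedFacet → Bool
  | .top => t
  | .base => !t
  | .cut i => ![c₀, c₁, !c₀, !c₁] i
  | .lateral i => ![l₀, l₁, l₂, l₃] i

/-- There are only 128 assignments of the seven free signs, so exhaustion suffices; in each
admissible one six of the sixteen vertices are unmixed. -/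
theorem card_mixed_signs (t c₀ c₁ l₀ l₁ l₂ l₃ : Bool) :
    let σ := signs t c₀ c₁ l₀ l₁ l₂ l₃
    (∀ i, σ (cut i) → σ (lateral (i + 1)) → σ (lateral i)) →
    (∀ i, σ (cut i) → σ (lateral (i + 2)) → σ (lateral (i + 3))) →
    (∀ i, σ .top → σ (cut i) → σ (cut (i + 1)) → σ (lateral i)) →
    (∀ i, σ .base → σ (lateral i) → σ (cut i) ∨ σ (cut (i + 1))) →
    (Finset.univ.filter fun v => (∃ f ∈ facets v, σ f = false) ∧ ∃ f ∈ facets v, σ f = true).card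
      = 10 := by
  revert t c₀ c₁ l₀ l₁ l₂ l₃
  decide +kernel

theorem card_mixed (σ : EquitruncatedFacet → Bool) (hbase : σ .base = !σ .top)
    (hcut : ∀ i, σ (cut (i + 2)) = !σ (cut i))
    (h₁ : ∀ i, σ (cut i) → σ (lateral (i + 1)) → σ (lateral i))
    (h₂ : ∀ i, σ (cut i) → σ (lateral (i + 2)) → σ (lateral (i + 3)))
    (h₃ : ∀ i, σ .top → σ (cut i) → σ (cut (i + 1)) → σ (lateral i))
    (h₄ : ∀ i, σ .base → σ (lateral i) → σ (cut i) ∨ σ (cut (i + 1))) :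
    (Finset.univ.filter fun v => (∃ f ∈ facets v, σ f = false) ∧ ∃ f ∈ facets v, σ f = true).card
      = 10 := by
  have hσ : σ = signs (σ .top) (σ (cut 0)) (σ (cut 1)) (σ (lateral 0)) (σ (lateral 1))
      (σ (lateral 2)) (σ (lateral 3)) := by
    funext f
    rcases f with _ | _ | i | i
    · rfl
    · exact hbase
    · fin_cases i
      exacts [rfl, rfl, hcut 0, hcut 1]
    · fin_cases i <;> rfl
  have := card_mixed_signs (σ .top) (σ (cut 0)) (σ (cut 1)) (σ (lateral 0)) (σ (lateral 1))
      (σ (lateral 2)) (σ (lateral 3))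
  rw [← hσ] at this
  exact this h₁ h₂ h₃ h₄

end EquitruncatedVertex

/-! ### Facets and vertices of the equitruncated pyramid -/

/-- Positions of the cuts of a quadrilateral pyramid, as fractions of the lateral edges. -/
structure CutPositions where
  top : ℝ
  side : Fin 4 → ℝ
  top_pos : 0 < top
  top_lt_side : ∀ i, top < side i
  side_lt_one : ∀ i, side i < 1
  one_lt_side_add : ∀ i, 1 < side i + side (i + 1)

namespace PyramidFrame

variable {b : Fin 4 → Space3} (F : PyramidFrame b) (C : CutPositions) (o : Space3)

/-- The outer normals of the facets of the equitruncated pyramid. -/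
noncomputable def facetNormal : EquitruncatedFacet → StrongDual ℝ Space3
  | .top => -F.height
  | .base => F.height
  | .cut i => F.side i
  | .lateral i => F.side i + F.side (i + 1) - F.height

/-- The bounds of the facet inequalities of the equitruncated pyramid with apex at the origin. -/
def _root_.CutPositions.facetBound : EquitruncatedFacet → ℝ
  | .top => -C.top
  | .base => 1
  | .cut i => C.side i
  | .lateral _ => 0

/-- The vertices of the equitruncated pyramid with apex at the origin. -/
noncomputable def _root_.CutPositions.vertex (b : Fin 4 → Space3) : EquitruncatedVertex → Space3
  | .top i => C.top • b i
  | .edge i => C.side i • b i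
  | .next i => C.side i • b i + (1 - C.side i) • b (i + 1)
  | .prev i => C.side i • b i + (1 - C.side i) • b (i + 3)

theorem _root_.CutPositions.side_pos (i : Fin 4) : 0 < C.side i :=
  C.top_pos.trans (C.top_lt_side i)

theorem facetNormal_vertex_eq (v : EquitruncatedVertex) (f : EquitruncatedFacet)
    (hf : f ∈ v.facets) : F.facetNormal f (C.vertex b v) = C.facetBound f := by
  have key : ∀ i, F.side i (b i) = 1 ∧ F.side (i + 1) (b i) = 0 ∧ F.side (i + 3) (b i) = 0 ∧
      F.side (i + 1) (b (i + 1)) = 1 ∧ F.side (i + 3) (b (i + 3)) = 1 ∧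
      F.side i (b (i + 1)) = 0 ∧ F.side i (b (i + 3)) = 0 := fun i =>
    ⟨F.side_self i, F.side_add_one_edge i, by rw [F.side_add_three, F.side_add_one_edge]; simp,
      F.side_self _, F.side_self _, F.side_edge_add_one i, F.side_edge_add_three i⟩
  have e31 : ∀ i : Fin 4, i + 3 + 1 = i := by decide
  rcases v with i | i | i | i <;> obtain ⟨h1, h2, h3, h4, h5, h6, h7⟩ := key i <;>
    simp only [EquitruncatedVertex.facets, Finset.mem_insert, Finset.mem_singleton] at hf <;>
    obtain rfl | rfl | rfl := hf <;>
    simp [facetNormal, CutPositions.facetBound, CutPositions.vertex, F.height_edge, h1, h2, h3,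
      h4, h5, h6, h7, e31]

theorem facetNormal_vertex_lt (v : EquitruncatedVertex) (f : EquitruncatedFacet)
    (hf : f ∉ v.facets) : F.facetNormal f (C.vertex b v) < C.facetBound f := by
  obtain ⟨i, hi⟩ : ∃ i, v = .top i ∨ v = .edge i ∨ v = .next i ∨ v = .prev i := by
    rcases v with i | i | i | i <;> exact ⟨i, by simp⟩
  have e11 : i + 1 + 1 = i + 2 := by omega
  have e21 : i + 2 + 1 = i + 3 := by omega
  have e31 : i + 3 + 1 = i := by omega
  have hτ := C.top_pos
  have hτs := C.top_lt_side
  have hs := C.side_pos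
  have hs0 := hs i
  have hs1 := hs (i + 1)
  have hs2 := hs (i + 2)
  have hs3 := hs (i + 3)
  have hl := C.side_lt_one i
  have hl1 := sub_pos.2 hl
  -- These two bounds keep `next i` and `prev i` strictly inside the neighbouring cuts, whose side
  -- forms take the value `1 - C.side i` there.
  have hsum := C.one_lt_side_add i
  have hsum' := C.one_lt_side_add (i + 3)
  rw [e31] at hsum'
  have r0 := F.ratio_pos i
  have r1 := F.ratio_pos (i + 1)
  have r3 := F.ratio_pos (i + 3)
  have hr := F.ratio_add_one_mul_ratio i
  -- The only product of two ratios, arising at `prev i`, is removed so that the remaining goals are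
  -- linear.
  have hr' : F.ratio (i + 1) * (F.ratio (i + 3) * (1 - C.side i)) = 1 - C.side i := by
    rw [← mul_assoc, hr, one_mul]
  have p0 := mul_pos r0 hτ
  have p1 := mul_pos r0 hs0
  have p2 := mul_pos r1 hl1
  have p3 := mul_pos r3 hl1
  have p4 := C.top_lt_side i
  have q0 := F.side_self i
  have q1 := F.side_add_one_edge i
  have q2 := F.side_edge_add_one i
  have q3 := F.side_self (i + 1)
  have q4 := F.side_edge_add_three i
  have q5 := F.side_add_one_edge_add_three i
  rcases f with _ | _ | j | j
  · rcases hi with rfl | rfl | rfl | rfl <;>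
    simp [EquitruncatedVertex.facets, facetNormal, CutPositions.facetBound, CutPositions.vertex,
      F.height_edge] at hf ⊢ <;> linarith
  · rcases hi with rfl | rfl | rfl | rfl <;>
    simp [EquitruncatedVertex.facets, facetNormal, CutPositions.facetBound, CutPositions.vertex,
      F.height_edge] at hf ⊢ <;> linarith
  all_goals
    obtain rfl | rfl | rfl | rfl : i = j ∨ j = i + 1 ∨ j = i + 2 ∨ j = i + 3 := by omega
  all_goals
    rcases hi with rfl | rfl | rfl | rfl <;>
    simp [EquitruncatedVertex.facets, facetNormal, CutPositions.facetBound, CutPositions.vertex,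
      F.height_edge, e11, e21, e31, F.side_add_two i, F.side_add_three i, q0, q1, q2, q3, q4,
      q5] at hf ⊢ <;> linarith

/-- The three normals at each vertex are independent. On a lateral edge, the two lateral normals
differ by `1 + F.ratio (i + 1)` times the form `F.side (i + 1)`. -/
theorem eq_zero_of_facetNormal (v : EquitruncatedVertex) (d : Space3)
    (hd : ∀ f ∈ v.facets, F.facetNormal f d = 0) : d = 0 := by
  rcases v with i | i | i | i <;>
    simp [EquitruncatedVertex.facets, facetNormal, show i + 3 + 1 = i by omega,
      F.side_add_three i] at hd <;>
    obtain ⟨h1, h2, h3⟩ := hd <;>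
    have hr := F.ratio_pos (i + 1)
  · have : F.side (i + 1) d = 0 := by
      have : (1 + F.ratio (i + 1)) * F.side (i + 1) d = 0 := by linarith
      exact (mul_eq_zero.1 this).resolve_left (by positivity)
    exact F.eq_zero i (by linarith) this h1
  · have : F.side (i + 1) d = 0 := by
      have : (1 + F.ratio (i + 1)) * F.side (i + 1) d = 0 := by linarith
      exact (mul_eq_zero.1 this).resolve_left (by positivity)
    exact F.eq_zero i h1 this (by linarith)
  · exact F.eq_zero i h1 (by linarith) h2
  · have : F.ratio (i + 1) * F.side (i + 1) d = 0 := by linarith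
    exact F.eq_zero i h1 ((mul_eq_zero.1 this).resolve_left hr.ne') h2

/-- The facets and vertices of the equitruncated pyramid with apex `o`. -/
noncomputable def equitruncatedSystem :
    FacetVertexSystem EquitruncatedFacet EquitruncatedVertex where
  normal := F.facetNormal
  bound f := C.facetBound f + F.facetNormal f o
  vertex v := o + C.vertex b v
  tight := EquitruncatedVertex.facets
  eq_of_mem v f hf := by rw [map_add, F.facetNormal_vertex_eq C v f hf, add_comm]
  lt_of_notMem v f hf := by
    rw [map_add, add_comm]; exact add_lt_add_left (F.facetNormal_vertex_lt C v f hf) _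
  eq_zero_of_tight := F.eq_zero_of_facetNormal
  tight_injective := EquitruncatedVertex.facets_injective

/-- Writing `l i` for the lateral normals, `x i` for the side forms and `r i` for the ratios, the
sign implications come from `l i - l (i + 1) = l (i + 3) - l (i + 2) = (1 + r i) x i` and `l i + h =
x i + x (i + 1)`. -/
theorem ncard_isMixed (v : Space3) (hv : ∀ f, F.facetNormal f v ≠ 0) :
    {i | (F.equitruncatedSystem C o).IsMixed v i}.ncard = 10 := by
  have hneg : ∀ f, ¬ 0 < F.facetNormal f v ↔ F.facetNormal f v < 0 := fun f => by
    rw [not_lt]; exact ⟨fun h => h.lt_of_ne (hv f), le_of_lt⟩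
  have := EquitruncatedVertex.card_mixed (fun f => decide (0 < F.facetNormal f v)) ?_ ?_ ?_ ?_ ?_ ?_
  · rw [← this, ← Set.ncard_coe_finset]
    congr 1
    ext i
    simp [FacetVertexSystem.IsMixed, equitruncatedSystem, (hv _).le_iff_lt]
  · rw [← decide_not, decide_eq_decide, hneg]
    simp [facetNormal]
  · intro i
    rw [← decide_not, decide_eq_decide, hneg]
    simp only [facetNormal]
    rw [F.side_add_two]
    constructor <;> intro h <;> nlinarith [F.ratio_pos i]
  all_goals
    intro i
    have h0 := F.side_add_two i v
    have h1 := F.side_add_three i v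
    have r0 := F.ratio_pos i
    have r1 := F.ratio_pos (i + 1)
    have e11 : i + 1 + 1 = i + 2 := by omega
    have e21 : i + 2 + 1 = i + 3 := by omega
    have e31 : i + 3 + 1 = i := by omega
    simp only [decide_eq_true_eq]
    simp [facetNormal, e11, e21, e31, h0, h1]
  · intro h2 h3
    nlinarith
  · intro h2 h3
    nlinarith
  · intros
    linarith
  · intros
    by_contra! h
    linarith [h.1, h.2]

end PyramidFrame

/-! ### No further extreme points -/

/-- In a quadrant with coordinates `(u, w, h)`, a point of the equitruncated pyramid at which the
tight inequalities allow no move is one of the six vertices in this quadrant. -/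
theorem CutPositions.eq_vertex_of_rigid {τ s s' s₂ s₃ r r' u w h : ℝ}
    (hτ : 0 < τ) (hs : τ < s) (hs' : τ < s') (hs1 : s < 1) (hs1' : s' < 1) (hss : 1 < s + s')
    (hs₂ : 0 < s₂) (hs₃ : 0 < s₃) (hr : 0 < r) (hr' : 0 < r') (hu : 0 ≤ u) (hw : 0 ≤ w)
    (h0 : τ ≤ h) (huw : u + w ≤ h)
    (H : ∀ du dw dh : ℝ, (h = τ → dh = 0) → (h = 1 → dh = 0) → (u = s → du = 0) →
      (w = s' → dw = 0) → (-(r * u) = s₂ → r * du = 0) → (-(r' * w) = s₃ → r' * dw = 0) →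
      (u + w = h → du + dw = dh) → (w - r * u = h → dw - r * du = dh) →
      (-(r * u) - r' * w = h → -(r * du) - r' * dw = dh) →
      (u - r' * w = h → du - r' * dw = dh) → du = 0 ∧ dw = 0 ∧ dh = 0)
    (h1 : h ≤ 1) (hus : u ≤ s) (hws : w ≤ s') :
    (u = τ ∧ w = 0 ∧ h = τ) ∨ (u = 0 ∧ w = τ ∧ h = τ) ∨ (u = s ∧ w = 0 ∧ h = s) ∨
      (u = 0 ∧ w = s' ∧ h = s') ∨ (u = s ∧ w = 1 - s ∧ h = 1) ∨
      (u = 1 - s' ∧ w = s' ∧ h = 1) := by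
  have hru := mul_nonneg hr.le hu
  have hrw := mul_nonneg hr'.le hw
  -- In each case that is not a listed vertex, `H` is applied to a nonzero direction annihilated by
  -- every constraint that can be tight: horizontal when the lateral facet is slack, otherwise along
  -- that facet.
  rcases hu.eq_or_lt with rfl | hu0 <;> rcases hw.eq_or_lt with rfl | hw0
  · exfalso
    refine absurd (H 1 0 0 ?_ ?_ ?_ ?_ ?_ ?_ ?_ ?_ ?_ ?_) (by simp) <;> intro <;>
      linarith
  · by_contra hcon
    by_cases hl : w = h
    · subst hl
      refine absurd (H 0 1 1 ?_ ?_ ?_ ?_ ?_ ?_ ?_ ?_ ?_ ?_) (by simp) <;> intro <;>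
        first | linarith | grind
    · refine absurd (H 1 0 0 ?_ ?_ ?_ ?_ ?_ ?_ ?_ ?_ ?_ ?_) (by simp) <;> intro <;>
        first | linarith | grind
  · by_contra hcon
    by_cases hl : u = h
    · subst hl
      refine absurd (H 1 0 1 ?_ ?_ ?_ ?_ ?_ ?_ ?_ ?_ ?_ ?_) (by simp) <;> intro <;>
        first | linarith | grind
    · refine absurd (H 0 1 0 ?_ ?_ ?_ ?_ ?_ ?_ ?_ ?_ ?_ ?_) (by simp) <;> intro <;>
        first | linarith | grind
  · have hru0 := mul_pos hr hu0
    have hrw0 := mul_pos hr' hw0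
    by_cases hus' : u = s <;> by_cases hws' : w = s'
    -- Both cuts cannot be tight, since `u + w ≤ h ≤ 1 < s + s'`.
    · exfalso; linarith
    · by_cases hl : u + w = h
      · by_cases hh : h = 1
        · exact Or.inr (Or.inr (Or.inr (Or.inr (Or.inl ⟨hus', by linarith, hh⟩))))
        · exfalso
          refine absurd (H 0 1 1 ?_ ?_ ?_ ?_ ?_ ?_ ?_ ?_ ?_ ?_) (by simp) <;> intro <;>
            first | linarith | grind
      · exfalso
        refine absurd (H 0 1 0 ?_ ?_ ?_ ?_ ?_ ?_ ?_ ?_ ?_ ?_) (by simp) <;> intro <;>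
          first | linarith | grind
    · by_cases hl : u + w = h
      · by_cases hh : h = 1
        · exact Or.inr (Or.inr (Or.inr (Or.inr (Or.inr ⟨by linarith, hws', hh⟩))))
        · exfalso
          refine absurd (H 1 0 1 ?_ ?_ ?_ ?_ ?_ ?_ ?_ ?_ ?_ ?_) (by simp) <;> intro <;>
            first | linarith | grind
      · exfalso
        refine absurd (H 1 0 0 ?_ ?_ ?_ ?_ ?_ ?_ ?_ ?_ ?_ ?_) (by simp) <;> intro <;>
          first | linarith | grind
    · exfalso
      by_cases hl : u + w = h
      · refine absurd (H 1 (-1) 0 ?_ ?_ ?_ ?_ ?_ ?_ ?_ ?_ ?_ ?_) (by simp) <;> intro <;>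
          first | linarith | grind
      · refine absurd (H 1 0 0 ?_ ?_ ?_ ?_ ?_ ?_ ?_ ?_ ?_ ?_) (by simp) <;> intro <;>
          first | linarith | grind

namespace PyramidFrame

variable {b : Fin 4 → Space3} (F : PyramidFrame b) (C : CutPositions) (o : Space3)

theorem vertex_eq_iff (i : Fin 4) (v : EquitruncatedVertex) (x : Space3) :
    (F.equitruncatedSystem C o).vertex v = x ↔
      F.side i (C.vertex b v) = F.side i (x - o) ∧
      F.side (i + 1) (C.vertex b v) = F.side (i + 1) (x - o) ∧
      F.height (C.vertex b v) = F.height (x - o) := by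
  rw [show (F.equitruncatedSystem C o).vertex v = o + C.vertex b v from rfl, ← eq_sub_iff_add_eq']
  exact ⟨fun h => by simp only [h, and_self], fun h => F.ext_coord i h.1 h.2.1 h.2.2⟩

/-- At an extreme point no nonzero direction is annihilated by all tight normals. Reading this in
the coordinates of a quadrant containing the point reduces the claim to
`CutPositions.eq_vertex_of_rigid`. -/
theorem extremePoints_carrier_subset : (F.equitruncatedSystem C o).carrier.extremePoints ℝ ⊆
    Set.range (F.equitruncatedSystem C o).vertex := by
  intro x hx
  have H := (F.equitruncatedSystem C o).eq_zero_of_extreme hx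
  have hmem := hx.1
  have heq : ∀ f, (F.equitruncatedSystem C o).normal f x = (F.equitruncatedSystem C o).bound f ↔
      F.facetNormal f (x - o) = C.facetBound f := fun f => by
    rw [map_sub, sub_eq_iff_eq_add]; rfl
  have hle : ∀ f, F.facetNormal f (x - o) ≤ C.facetBound f := fun f => by
    rw [map_sub, sub_le_iff_le_add]; exact hmem f
  replace H : ∀ d, (∀ f, F.facetNormal f (x - o) = C.facetBound f → F.facetNormal f d = 0) →
      d = 0 := fun d hd => H d fun f hf => hd f ((heq f).1 hf)
  obtain ⟨i, hi, hi'⟩ := F.exists_quadrant (x - o)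
  have e11 : i + 1 + 1 = i + 2 := by omega
  have e21 : i + 2 + 1 = i + 3 := by omega
  have e31 : i + 3 + 1 = i := by omega
  have e13 : i + 1 + 3 = i := by omega
  have hx2 := F.side_add_two i (x - o)
  have hx3 := F.side_add_three i (x - o)
  have key := CutPositions.eq_vertex_of_rigid C.top_pos (C.top_lt_side i) (C.top_lt_side (i + 1))
    (C.side_lt_one i) (C.side_lt_one (i + 1)) (C.one_lt_side_add i) (C.side_pos (i + 2))
    (C.side_pos (i + 3)) (F.ratio_pos i) (F.ratio_pos (i + 1)) hi hi'
    (h := F.height (x - o)) (neg_le_neg_iff.1 (hle .top)) (sub_nonpos.1 (hle (.lateral i)))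
    (fun du dw dh a1 a2 a3 a4 a5 a6 a7 a8 a9 a10 => by
      -- The vector with prescribed coordinates, as in `eq_combination`.
      set d := du • b i + dw • b (i + 1) + (dh - du - dw) • F.cross with hd
      have d0 : F.side i d = du := by
        simp [hd, F.side_self, F.side_edge_add_one, F.side_cross]
      have d1 : F.side (i + 1) d = dw := by
        simp [hd, F.side_self, F.side_add_one_edge, F.side_cross]
      have d2 : F.height d = dh := by
        simp [hd, F.height_edge, F.height_cross]
      have hd0 : d = 0 := by
        refine H d fun f hf => ?_
        have d3 := F.side_add_two i d
        have d4 := F.side_add_three i d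
        rw [d0] at d3
        rw [d1] at d4
        rcases f with _ | _ | j | j
        · exact neg_eq_zero.2 (d2.trans (a1 (neg_inj.1 hf)))
        · exact d2.trans (a2 hf)
        · obtain rfl | rfl | rfl | rfl : i = j ∨ j = i + 1 ∨ j = i + 2 ∨ j = i + 3 := by omega
          · exact d0.trans (a3 hf)
          · exact d1.trans (a4 hf)
          · exact d3.trans (neg_eq_zero.2 (a5 (hx2.symm.trans hf)))
          · exact d4.trans (neg_eq_zero.2 (a6 (hx3.symm.trans hf)))
        · obtain rfl | rfl | rfl | rfl : i = j ∨ j = i + 1 ∨ j = i + 2 ∨ j = i + 3 := by omega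
          · have hf' : F.side i (x - o) + F.side (i + 1) (x - o) - F.height (x - o) = 0 := hf
            have := a7 (by linarith)
            simp only [facetNormal, add_apply, sub_apply, d0, d1, d2]
            linarith
          · have hf' : F.side (i + 1) (x - o) + F.side (i + 1 + 1) (x - o) - F.height (x - o) = 0 :=
              hf
            rw [e11, hx2] at hf'
            have := a8 (by linarith)
            simp only [facetNormal, add_apply, sub_apply, e11, d1, d2, d3]
            linarith
          · have hf' : F.side (i + 2) (x - o) + F.side (i + 2 + 1) (x - o) - F.height (x - o) = 0 :=
              hf
            rw [e21, hx2, hx3] at hf'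
            have := a9 (by linarith)
            simp only [facetNormal, add_apply, sub_apply, e21, d2, d3, d4]
            linarith
          · have hf' : F.side (i + 3) (x - o) + F.side (i + 3 + 1) (x - o) - F.height (x - o) = 0 :=
              hf
            rw [e31, hx3] at hf'
            have := a10 (by linarith)
            simp only [facetNormal, add_apply, sub_apply, e31, d0, d2, d4]
            linarith
      rw [hd0, map_zero] at d0 d1 d2
      exact ⟨d0.symm, d1.symm, d2.symm⟩)
    (hle .base) (hle (.cut i)) (hle (.cut (i + 1)))
  rcases key with ⟨h1, h2, h3⟩ | ⟨h1, h2, h3⟩ | ⟨h1, h2, h3⟩ | ⟨h1, h2, h3⟩ | ⟨h1, h2, h3⟩ |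
    ⟨h1, h2, h3⟩
  · refine ⟨.top i, (F.vertex_eq_iff C o i _ x).2 ?_⟩
    simp [-map_sub, h1, h2, h3, CutPositions.vertex, F.side_self, F.side_add_one_edge, F.height_edge]
  · refine ⟨.top (i + 1), (F.vertex_eq_iff C o i _ x).2 ?_⟩
    simp [-map_sub, h1, h2, h3, CutPositions.vertex, F.side_self, F.side_edge_add_one, F.height_edge]
  · refine ⟨.edge i, (F.vertex_eq_iff C o i _ x).2 ?_⟩
    simp [-map_sub, h1, h2, h3, CutPositions.vertex, F.side_self, F.side_add_one_edge, F.height_edge]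
  · refine ⟨.edge (i + 1), (F.vertex_eq_iff C o i _ x).2 ?_⟩
    simp [-map_sub, h1, h2, h3, CutPositions.vertex, F.side_self, F.side_edge_add_one, F.height_edge]
  · refine ⟨.next i, (F.vertex_eq_iff C o i _ x).2 ?_⟩
    simp [-map_sub, h1, h2, h3, CutPositions.vertex, F.side_self, F.side_add_one_edge, F.side_edge_add_one,
      F.height_edge]
  · refine ⟨.prev (i + 1), (F.vertex_eq_iff C o i _ x).2 ?_⟩
    simp [-map_sub, h1, h2, h3, CutPositions.vertex, F.side_self, F.side_add_one_edge, F.side_edge_add_one,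
      F.height_edge, e13]

end PyramidFrame

/-! ### Conclusion -/

theorem QuadPyramid.Cuts.exists_equitruncated_eq_carrier {Q : QuadPyramid} (c : Q.Cuts)
    (F : PyramidFrame fun i => Q.base i - Q.apex) :
    ∃ C : CutPositions, c.equitruncated = (F.equitruncatedSystem C Q.apex).carrier := by
  obtain ⟨τ, s, h1, h2, h3, h4, h⟩ := c.exists_equitruncated_eq F
  refine ⟨⟨τ, s, h1, h2, h3, h4⟩, Set.ext fun x => (h x).trans ?_⟩
  have hmem : x ∈ (F.equitruncatedSystem ⟨τ, s, h1, h2, h3, h4⟩ Q.apex).carrier ↔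
      ∀ f, F.facetNormal f (x - Q.apex) ≤ CutPositions.facetBound ⟨τ, s, h1, h2, h3, h4⟩ f :=
    forall_congr' fun f => by rw [map_sub, sub_le_iff_le_add]; rfl
  rw [hmem]
  constructor
  · rintro ⟨a1, a2, a3, a4⟩ (_ | _ | i | i)
    · exact neg_le_neg a2
    · exact a1
    · exact a3 i
    · exact sub_nonpos.2 (a4 i)
  · intro a
    exact ⟨a .base, neg_le_neg_iff.1 (a .top), fun i => a (.cut i),
      fun i => sub_nonpos.1 (a (.lateral i))⟩

theorem QuadPyramid.isBounded_solid (Q : QuadPyramid) : Bornology.IsBounded Q.solid :=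
  isBounded_convexHull.2 ((Set.finite_range Q.base).insert Q.apex).isBounded

theorem mainTheorem3 (Q : QuadPyramid) (c : Q.Cuts) : IsEquiprojective 10 c.equitruncated := by
  obtain ⟨F⟩ := Q.nonempty_frame
  have hb : Bornology.IsBounded c.equitruncated := Q.isBounded_solid.subset (Set.sep_subset _ _)
  obtain ⟨C, hC⟩ := c.exists_equitruncated_eq_carrier F
  rw [hC] at hb ⊢
  set S := F.equitruncatedSystem C Q.apex with hS
  have hi : (interior S.carrier).Nonempty := by
    -- The average of all vertices is interior, since every inequality is strict at some vertex.
    obtain ⟨z, -, -, hz⟩ := S.exists_average Finset.univ ⟨.top 0, Finset.mem_univ _⟩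
    refine ⟨z, S.mem_interior_of_lt fun f => hz f ?_⟩
    obtain ⟨g, hg⟩ : ∃ g, f ≠ g := by
      cases f
      exacts [⟨.base, by decide⟩, ⟨.top, by decide⟩, ⟨.base, by simp⟩, ⟨.base, by simp⟩]
    obtain ⟨i, -, hi⟩ := EquitruncatedVertex.exists_mem_facets_and_notMem g f hg
    exact ⟨i, Finset.mem_univ _, hi⟩
  have hcomp : IsCompact S.carrier := Metric.isCompact_of_isClosed_isBounded S.isClosed_carrier hb
  refine ⟨S.isConvexPolyhedron hb hi, fun v hv hpar => ?_⟩
  have hv' : ∀ f, F.facetNormal f v ≠ 0 := by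
    intro f hf
    obtain ⟨g, hg⟩ : ∃ g, g ≠ f := by
      cases f
      exacts [⟨.base, by decide⟩, ⟨.top, by decide⟩, ⟨.base, by simp⟩, ⟨.base, by simp⟩]
    obtain ⟨i, hi, -⟩ := EquitruncatedVertex.exists_mem_facets_and_notMem f g hg
    obtain ⟨j, -, hj⟩ := EquitruncatedVertex.exists_mem_facets_and_notMem g f hg.symm
    exact hpar (S.isParallelToFace_of_normal_eq_zero f ⟨i, hi⟩ ⟨j, hj⟩
      (EquitruncatedVertex.exists_mem_facets_and_notMem f) hf)
  exact S.isConvexPolygon_shadow hcomp hi (F.extremePoints_carrier_subset C Q.apex) hv hv'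
    (F.ncard_isMixed C Q.apex v hv')
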